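/- Let $n\ge 1$. A cube is a half-open cube $Q=\prod_{i=1}^n[a_i,a_i+\ell)$ with $a\in\mathbb R^n$, $\ell>0$, and $|Q|$ is its Lebesgue measure. For a cube $Q_0$ let $\mathcal D(Q_0)$ be the set of its dyadic subcubes, obtained by repeatedly bisecting the sides of $Q_0$ ($Q_0$ included), and let $\mathcal D(\mathbb R^n)=\{2^k(m+[0,1)^n): k\in\mathbb Z,\ m\in\mathbb Z^n\}$. Let $\Omega$ be either a cube $Q_0$ or $\mathbb R^n$. A countable family $(Q_i)_{i\in I}$ in $\mathcal D(\Omega)$ (repetitions allowed) is sparse if there are pairwise disjoint measurable sets $E_i\subseteq Q_i$ with $|E_i|\ge\frac12|Q_i|$ for all $i\in I$; let $S(\Omega)$ be the set of all sparse families in $\mathcal D(\Omega)$. Write $b_-=\min\{b,0\}$ and $\frac1{p'}=1-\frac1p$. For $f\in L^1(Q_0)$ if $\Omega=Q_0$, and for $f\in L^1_{\mathrm{loc}}(\mathbb R^n)$ if $\Omega=\mathbb R^n$, define with values in $[0,\infty]$ $$\|f\|_{SR_{p,q}\log^\alpha(\Omega)}=\sup_{(Q_i)_{i\in I}\in S(\Omega)}\Big\{\sum_{i\in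 I}\Big[\frac{(1-(\log|Q_i|)_-)^\alpha}{|Q_i|^{1/p'}}\int_{Q_i}|f|\Big]^q\Big\}^{1/q},$$ $$M_{\lambda,\alpha,\Omega}f(x)=\sup_{Q\in\mathcal D(\Omega),\ x\in Q}|Q|^{\frac{\lambda}{n}-1}(1-(\log|Q|)_-)^\alpha\int_Q|f(y)|\,dy,\qquad x\in\Omega.$$ Let $SR_{p,q}\log^\alpha(\Omega)$ be the set of all such $f$ with $\|f\|_{SR_{p,q}\log^\alpha(\Omega)}<\infty$, and $M_{\lambda,\alpha,\Omega}L^q(\Omega)$ the set of all such $f$ with $\|M_{\lambda,\alpha,\Omega}f\|_{L^q(\Omega)}<\infty$. **Theorem.** Let $1\le p\le q<\infty$ and $\alpha\in\mathbb R$, with $\alpha\le0$ if $p=q$, and put $\lambda=n(\frac1p-\frac1q)$. Then there is a constant $C\in(0,\infty)$, depending only on $n,p,q,\alpha$, such that for $\Omega=\mathbb R^n$ and for every cube $\Omega=Q_0$, $$SR_{p,q}\log^\alpha(\Omega)=M_{\lambda,\alpha,\Omega}L^q(\Omega),$$ and, for every $f\in L^1(Q_0)$ if $\Omega=Q_0$,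 respectively every $f\in L^1_{\mathrm{loc}}(\mathbb R^n)$ if $\Omega=\mathbb R^n$, $$C^{-1}\,\|M_{\lambda,\alpha,\Omega}f\|_{L^q(\Omega)}\le\|f\|_{SR_{p,q}\log^\alpha(\Omega)}\le C\,\|M_{\lambda,\alpha,\Omega}f\|_{L^q(\Omega)}.$$ -/

import Mathlib

open MeasureTheory
open scoped ENNReal NNReal

namespace SparseRMT

noncomputable section

/-- The half-open cube `∏ᵢ [aᵢ, aᵢ + ℓ)` in `ℝⁿ`, with lower corner `a` and side length `ℓ`. -/
def cube {n : ℕ} (a : Fin n → ℝ) (ℓ : ℝ) : Set (Fin n → ℝ) :=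
  {x | ∀ i, a i ≤ x i ∧ x i < a i + ℓ}

/-- The dyadic subcubes of `Q₀ = cube a ℓ`: at generation `k` the cube `Q₀` is split into the `2^(nk)`
pairwise disjoint cubes of side length `ℓ / 2^k`. The cube `Q₀` itself is generation `0`. -/
def dyadicIn {n : ℕ} (a : Fin n → ℝ) (ℓ : ℝ) : Set (Set (Fin n → ℝ)) :=
  {Q | ∃ (k : ℕ) (m : Fin n → ℕ), (∀ i, m i < 2 ^ k) ∧
    Q = cube (fun i => a i + (m i : ℝ) * (ℓ / 2 ^ k)) (ℓ / 2 ^ k)}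

/-- The standard dyadic cubes `2^k (m + [0,1)ⁿ)`, `k ∈ ℤ`, `m ∈ ℤⁿ`, of `ℝⁿ`. -/
def dyadic (n : ℕ) : Set (Set (Fin n → ℝ)) :=
  {Q | ∃ (k : ℤ) (m : Fin n → ℤ), Q = cube (fun i => (m i : ℝ) * (2 : ℝ) ^ k) ((2 : ℝ) ^ k)}

/-- A family `(Qᵢ)` is sparse (with parameter `1/2`) if there are pairwise disjoint measurable sets
`Eᵢ ⊆ Qᵢ` with `|Qᵢ| / 2 ≤ |Eᵢ|`. Repetitions in the family are allowed. -/
def IsSparse {n : ℕ} {ι : Type*} (Q : ι → Set (Fin n → ℝ)) : Prop :=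
  ∃ E : ι → Set (Fin n → ℝ),
    (∀ i, MeasurableSet (E i)) ∧ (∀ i, E i ⊆ Q i) ∧
    (∀ i j, i ≠ j → Disjoint (E i) (E j)) ∧
    ∀ i, volume (Q i) / 2 ≤ volume (E i)

/-- The weight `(1 - (log t)₋)^α`, where `b₋ = min {b, 0}`. -/
def logWeight (α t : ℝ) : ℝ := (1 - min (Real.log t) 0) ^ α

/-- The sparse Riesz-Morrey-Tadmor norm with respect to a collection `D` of cubes, with values in
`[0, ∞]`: the supremum over all countable sparse families `(Qᵢ)` of members of `D` of
`(∑ᵢ ((1 - (log |Qᵢ|)₋)^α / |Qᵢ|^(1/p') * ∫_{Qᵢ} |f|)^q)^(1/q)`, where `1/p' = 1 - 1/p`.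
Countable families are indexed by subsets `I` of `ℕ`. -/
def sparseNorm {n : ℕ} (D : Set (Set (Fin n → ℝ))) (p q α : ℝ) (f : (Fin n → ℝ) → ℝ) : ℝ≥0∞ :=
  ⨆ (I : Set ℕ) (Q : I → Set (Fin n → ℝ)) (_ : ∀ i, Q i ∈ D) (_ : IsSparse Q),
    (∑' i, (ENNReal.ofReal (logWeight α (volume.real (Q i)) / volume.real (Q i) ^ (1 - 1 / p)) *
      ∫⁻ y in Q i, ‖f y‖ₑ) ^ q) ^ (1 / q)

/-- The log-weighted fractional maximal function with respect to a collection `D` of cubes, with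
values in `[0, ∞]`: the supremum over `Q ∈ D` with `x ∈ Q` of
`|Q|^(s/n - 1) (1 - (log |Q|)₋)^α ∫_Q |f|`. -/
def maximalFn {n : ℕ} (D : Set (Set (Fin n → ℝ))) (s α : ℝ) (f : (Fin n → ℝ) → ℝ)
    (x : Fin n → ℝ) : ℝ≥0∞ :=
  ⨆ (Q : Set (Fin n → ℝ)) (_ : Q ∈ D) (_ : x ∈ Q),
    ENNReal.ofReal (volume.real Q ^ (s / n - 1) * logWeight α (volume.real Q)) *
      ∫⁻ y in Q, ‖f y‖ₑ

/-- The sparse space on the cube `Q₀ = cube a ℓ`. -/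
def sparseSpaceOn {n : ℕ} (a : Fin n → ℝ) (ℓ p q α : ℝ) : Set ((Fin n → ℝ) → ℝ) :=
  {f | IntegrableOn f (cube a ℓ) ∧ sparseNorm (dyadicIn a ℓ) p q α f < ∞}

/-- The functions in `L¹(Q₀)` whose maximal function over `Q₀ = cube a ℓ` is in `L^q(Q₀)`. -/
def maximalSpaceOn {n : ℕ} (a : Fin n → ℝ) (ℓ s α q : ℝ) : Set ((Fin n → ℝ) → ℝ) :=
  {f | IntegrableOn f (cube a ℓ) ∧
    eLpNorm (maximalFn (dyadicIn a ℓ) s α f) (ENNReal.ofReal q)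
      (volume.restrict (cube a ℓ)) < ∞}

/-- The sparse space on `ℝⁿ`. -/
def sparseSpace (n : ℕ) (p q α : ℝ) : Set ((Fin n → ℝ) → ℝ) :=
  {f | LocallyIntegrable f ∧ sparseNorm (dyadic n) p q α f < ∞}

/-- The locally integrable functions on `ℝⁿ` whose maximal function is in `L^q(ℝⁿ)`. -/
def maximalSpace (n : ℕ) (s α q : ℝ) : Set ((Fin n → ℝ) → ℝ) :=
  {f | LocallyIntegrable f ∧
    eLpNorm (maximalFn (dyadic n) s α f) (ENNReal.ofReal q) volume < ∞}

end

end SparseRMT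

namespace SparseRMT

open Set

noncomputable section

/-! Put g(Q) = |Q|^(λ/n-1) (1-(log|Q|)₋)^α ∫_Q |f|. Since λ/n = 1/p - 1/q, each term of the sparse
norm, q-th power included, equals |Q| g(Q)^q (`sparse_term_eq`), so both sides are built from g.

Sparse sum ≤ maximal function: |Q_i| ≤ 2|E_i|, g(Q_i) ≤ Mf on E_i, and the E_i are disjoint.

Maximal function ≤ sparse sum: for cubes of bounded size, select principal cubes. A cube is kept
unless a kept strictly larger cube P has g(Q) ≤ 2K g(P). Each cube then lies in a kept one
controlling it up to 2K, so (Mf)^q ≤ (2K)^q ∑ g(Q)^q 1_Q over kept Q. Kept cubes strictly inside a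
kept Q satisfy g > 2K g(Q); by a weak type bound (`IsGrid.measure_bad_le`) they fill at most half of
Q, and what remains of Q serves as its set E.

The weak type bound needs t^(1/p-1/q) (1-(log t)₋)^α to be increasing up to the factor K. This is
where α ≤ 0 for p = q enters. Monotone convergence removes the size bound. -/

/-! ### Principal cubes in an abstract grid -/

/-- A graph whose edges increase a natural-valued rank has a kernel. -/
theorem exists_kernel {β : Type*} (rank : β → ℕ) (R : β → β → Prop)
    (hR : ∀ P Q, R P Q → rank P < rank Q) :
    ∃ S : Set β, ∀ Q, Q ∈ S ↔ ∀ P ∈ S, ¬ R P Q := by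
  have hwf : WellFounded (fun P Q : β => rank P < rank Q) := (measure rank).wf
  -- Membership is decided by recursion on rank: every candidate for excluding `Q` has smaller rank.
  let F : ∀ Q : β, (∀ P, rank P < rank Q → Prop) → Prop :=
    fun Q ih => ∀ P (h : R P Q), ¬ ih P (hR P Q h)
  refine ⟨{Q | hwf.fix F Q}, fun Q => ?_⟩
  simp only [mem_ofPred_eq]
  rw [hwf.fix_eq]
  exact ⟨fun h P hP hPQ => h P hPQ hP, fun h P hPQ hP => h P hP hPQ⟩

/-- Nested families of measurable sets in which strict inclusion increases a rank. -/
structure IsGrid {X : Type*} [MeasurableSpace X] (D : Set (Set X)) (rank : Set X → ℕ) : Prop where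
  countable : D.Countable
  measurableSet : ∀ Q ∈ D, MeasurableSet Q
  nested : ∀ P ∈ D, ∀ Q ∈ D, P ⊆ Q ∨ Q ⊆ P ∨ Disjoint P Q
  rank_lt : ∀ P ∈ D, ∀ Q ∈ D, P ⊂ Q → rank Q < rank P

variable {X : Type*} [MeasurableSpace X]

/-- Enlarging a set strictly lowers its rank, so a member of least rank above `P` is maximal. This
is why cubes of unbounded size must be truncated. -/
theorem IsGrid.exists_maximal {D : Set (Set X)} {rank : Set X → ℕ} (hD : IsGrid D rank)
    {B : Set (Set X)} (hB : B ⊆ D) {P : Set X} (hP : P ∈ B) :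
    ∃ M ∈ B, P ⊆ M ∧ ∀ M' ∈ B, M ⊆ M' → M' = M := by
  obtain ⟨M, ⟨hMB, hPM⟩, hmin⟩ :=
    (measure rank).wf.has_min {M | M ∈ B ∧ P ⊆ M} ⟨P, hP, subset_rfl⟩
  refine ⟨M, hMB, hPM, fun M' hM' hMM' => ?_⟩
  by_contra hne
  exact hmin M' ⟨hM', hPM.trans hMM'⟩
    (hD.rank_lt M (hB hMB) M' (hB hM') (hMM'.ssubset_of_ne (Ne.symm hne)))

/-- The maximal members of a subfamily of a grid are disjoint and have the same union. -/
theorem IsGrid.exists_disjoint_cover {D : Set (Set X)} {rank : Set X → ℕ} (hD : IsGrid D rank)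
    {B : Set (Set X)} (hB : B ⊆ D) :
    ∃ M ⊆ B, M.PairwiseDisjoint id ∧ ⋃₀ M = ⋃₀ B := by
  refine ⟨{M | M ∈ B ∧ ∀ M' ∈ B, M ⊆ M' → M' = M}, fun M h => h.1, ?_, ?_⟩
  · rintro P ⟨hP, hPm⟩ Q ⟨hQ, hQm⟩ hne
    rcases hD.nested P (hB hP) Q (hB hQ) with h | h | h
    · exact absurd (hPm Q hQ h).symm hne
    · exact absurd (hQm P hP h) hne
    · exact h
  · refine Subset.antisymm (sUnion_subset_sUnion fun M h => h.1) ?_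
    rintro x ⟨P, hP, hx⟩
    obtain ⟨M, hM, hPM, hmax⟩ := hD.exists_maximal hB hP
    exact ⟨M, ⟨hM, hmax⟩, hPM hx⟩

/-- The weighted integral of `f` over `Q`. -/
def weightedAvg (μ : Measure X) (W : Set X → ℝ≥0∞) (f : X → ℝ) (Q : Set X) : ℝ≥0∞ :=
  W Q * ∫⁻ y in Q, ‖f y‖ₑ ∂μ

/-- Weak type estimate: the subsets of `Q` on which the weighted integral exceeds `2K` times
that over `Q` fill at most half of `Q`. -/
theorem IsGrid.measure_bad_le {D : Set (Set X)} {rank : Set X → ℕ} (hD : IsGrid D rank)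
    (μ : Measure X) (W : Set X → ℝ≥0∞) (f : X → ℝ) {K : ℝ≥0} (hK : K ≠ 0)
    (hW : ∀ P ∈ D, ∀ Q ∈ D, P ⊆ Q → μ P * W P ≤ K * (μ Q * W Q))
    (hWt : ∀ Q ∈ D, W Q ≠ 0) {Q : Set X} (hQ : Q ∈ D) :
    μ (⋃₀ {P | P ∈ D ∧ P ⊆ Q ∧ 2 * K * weightedAvg μ W f Q < weightedAvg μ W f P}) ≤ μ Q / 2 := by
  set g := weightedAvg μ W f with hg
  set B := {P | P ∈ D ∧ P ⊆ Q ∧ 2 * K * g Q < g P} with hBdef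
  have hBD : B ⊆ D := fun P h => h.1
  -- The last step cancels `K * g Q`, so the values 0 and ∞ are treated apart; in both no bad set
  -- exists.
  rcases eq_or_ne (g Q) 0 with h0 | h0
  · have hB : B = ∅ := by
      refine eq_empty_iff_forall_notMem.2 fun P hP => ?_
      have h1 : ∫⁻ y in Q, ‖f y‖ₑ ∂μ = 0 := by
        rcases mul_eq_zero.1 h0 with h | h
        · exact absurd h (hWt Q hQ)
        · exact h
      have h2 : ∫⁻ y in P, ‖f y‖ₑ ∂μ = 0 :=
        le_antisymm ((lintegral_mono_set hP.2.1).trans h1.le) (zero_le)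
      have h3 : g P = 0 := by simp [hg, weightedAvg, h2]
      exact absurd hP.2.2 (by simp [h3])
    simp [hB]
  rcases eq_or_ne (g Q) ∞ with ht | ht
  · have hB : B = ∅ := by
      refine eq_empty_iff_forall_notMem.2 fun P hP => ?_
      have h := hP.2.2
      rw [ht, ENNReal.mul_top (by simpa using hK)] at h
      exact not_top_lt h
    simp [hB]
  obtain ⟨M, hMB, hMd, hMU⟩ := hD.exists_disjoint_cover hBD
  rw [← hMU]
  have hMc : M.Countable := hD.countable.mono (hMB.trans hBD)
  have hMm : ∀ P ∈ M, MeasurableSet P := fun P hP => hD.measurableSet P (hBD (hMB hP))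
  have hsub : ⋃₀ M ⊆ Q := sUnion_subset fun P hP => (hMB hP).2.1
  -- On disjoint bad sets, `μ P * g P` is `μ P * W P` times the integral over `P`; almost
  -- monotonicity of `μ * W` leaves integrals that add up inside `Q`.
  have key : 2 * K * g Q * μ (⋃₀ M) ≤ K * (μ Q * g Q) := by
    have : Countable M := hMc.to_subtype
    calc 2 * K * g Q * μ (⋃₀ M) = ∑' P : M, 2 * K * g Q * μ P := by
          rw [measure_sUnion hMc hMd hMm, ENNReal.tsum_mul_left]
      _ ≤ ∑' P : M, K * (μ Q * W Q) * ∫⁻ y in (P : Set X), ‖f y‖ₑ ∂μ := by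
          refine ENNReal.tsum_le_tsum fun P => ?_
          calc 2 * K * g Q * μ P ≤ g P * μ P := by gcongr; exact (hMB P.2).2.2.le
            _ = μ P * W P * ∫⁻ y in (P : Set X), ‖f y‖ₑ ∂μ := by
                simp only [hg, weightedAvg]; ring
            _ ≤ _ := mul_le_mul' (hW _ (hBD (hMB P.2)) _ hQ (hMB P.2).2.1) le_rfl
      _ = K * (μ Q * W Q) * ∫⁻ y in ⋃₀ M, ‖f y‖ₑ ∂μ := by
          rw [ENNReal.tsum_mul_left, sUnion_eq_iUnion,
            lintegral_iUnion (fun P : M => hMm P P.2)]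
          exact fun P Q h => hMd P.2 Q.2 (fun h' => h (Subtype.ext h'))
      _ ≤ K * (μ Q * W Q) * ∫⁻ y in Q, ‖f y‖ₑ ∂μ := by gcongr
      _ = K * (μ Q * g Q) := by simp only [hg, weightedAvg]; ring
  rw [ENNReal.le_div_iff_mul_le (by simp) (by simp)]
  have hc0 : (K : ℝ≥0∞) * g Q ≠ 0 := mul_ne_zero (by simpa using hK) h0
  have hct : (K : ℝ≥0∞) * g Q ≠ ∞ := ENNReal.mul_ne_top (by simp) ht
  rw [← ENNReal.mul_le_mul_iff_right hc0 hct]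
  calc K * g Q * (μ (⋃₀ M) * 2) = 2 * K * g Q * μ (⋃₀ M) := by ring
    _ ≤ _ := key
    _ = _ := by ring

/-- Principal subfamily: it is sparse and controls the weighted integrals over all members. -/
theorem IsGrid.exists_sparse {D : Set (Set X)} {rank : Set X → ℕ} (hD : IsGrid D rank)
    (μ : Measure X) (W : Set X → ℝ≥0∞) (f : X → ℝ) {K : ℝ≥0} (hK : 1 ≤ K)
    (hW : ∀ P ∈ D, ∀ Q ∈ D, P ⊆ Q → μ P * W P ≤ K * (μ Q * W Q))
    (hWt : ∀ Q ∈ D, W Q ≠ 0) (hμ : ∀ Q ∈ D, μ Q ≠ ∞) :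
    ∃ S ⊆ D, (∃ E : Set X → Set X, (∀ Q ∈ S, MeasurableSet (E Q)) ∧ (∀ Q ∈ S, E Q ⊆ Q) ∧
        (∀ P ∈ S, ∀ Q ∈ S, P ≠ Q → Disjoint (E P) (E Q)) ∧ ∀ Q ∈ S, μ Q / 2 ≤ μ (E Q)) ∧
      ∀ Q ∈ D, ∃ P ∈ S, Q ⊆ P ∧ weightedAvg μ W f Q ≤ 2 * K * weightedAvg μ W f P := by
  set g := weightedAvg μ W f with hg
  have hK0 : K ≠ 0 := (zero_lt_one.trans_le hK).ne'
  -- An edge from `P` to `Q` means that `P`, once selected, makes `Q` superfluous.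
  obtain ⟨S, hS⟩ := exists_kernel rank
    (fun P Q => P ∈ D ∧ Q ∈ D ∧ Q ⊂ P ∧ g Q ≤ 2 * K * g P)
    (fun P Q h => hD.rank_lt Q h.2.1 P h.1 h.2.2.1)
  let B : Set X → Set (Set X) := fun Q => {P | P ∈ D ∧ P ⊆ Q ∧ 2 * K * g Q < g P}
  have hBm : ∀ Q, MeasurableSet (⋃₀ B Q) := fun Q =>
    MeasurableSet.sUnion (hD.countable.mono fun P h => h.1) fun P h => hD.measurableSet P h.1
  have hBQ : ∀ Q, ⋃₀ B Q ⊆ Q := fun Q => sUnion_subset fun P hP => hP.2.1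
  have hstrict : ∀ P ∈ D ∩ S, ∀ Q ∈ D ∩ S, P ⊂ Q → P ⊆ ⋃₀ B Q := by
    rintro P ⟨hP, hPS⟩ Q ⟨hQ, hQS⟩ hPQ
    refine subset_sUnion_of_mem ⟨hP, hPQ.subset, ?_⟩
    by_contra hlt
    exact (hS P).1 hPS Q hQS ⟨hQ, hP, hPQ, not_lt.1 hlt⟩
  refine ⟨D ∩ S, inter_subset_left, ⟨fun Q => Q \ ⋃₀ B Q, ?_, ?_, ?_, ?_⟩, ?_⟩
  · exact fun Q hQ => (hD.measurableSet Q hQ.1).diff (hBm Q)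
  · exact fun Q _ => sdiff_subset
  · intro P hP Q hQ hne
    rcases hD.nested P hP.1 Q hQ.1 with h | h | h
    · exact (disjoint_sdiff_right.mono_left (hstrict P hP Q hQ (h.ssubset_of_ne hne))).mono_left
        sdiff_subset
    · exact ((disjoint_sdiff_right.mono_left
        (hstrict Q hQ P hP (h.ssubset_of_ne hne.symm))).mono_left sdiff_subset).symm
    · exact h.mono sdiff_subset sdiff_subset
  · intro Q hQ
    have hb := hD.measure_bad_le μ W f hK0 hW hWt hQ.1
    have hQt := hμ Q hQ.1
    rw [measure_sdiff (hBQ Q) (hBm Q).nullMeasurableSet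
      (ne_top_of_le_ne_top hQt (measure_mono (hBQ Q)))]
    calc μ Q / 2 = μ Q - μ Q / 2 := (ENNReal.sub_half hQt).symm
      _ ≤ _ := tsub_le_tsub_left hb _
  · intro Q hQ
    by_cases hQS : Q ∈ S
    · refine ⟨Q, ⟨hQ, hQS⟩, subset_rfl, le_mul_of_one_le_left' ?_⟩
      have : (1 : ℝ≥0∞) ≤ K := by exact_mod_cast hK
      exact one_le_mul_of_one_le_of_one_le (by norm_num) this
    · rw [hS] at hQS
      push Not at hQS
      obtain ⟨P, hPS, hP, -, hQP, hle⟩ := hQS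
      exact ⟨P, ⟨hP, hPS⟩, hQP.subset, hle⟩

/-! ### Maximal functions and sparse sums -/

/-- The maximal function attached to a family of sets and a weight. -/
def weightedMaximal (μ : Measure X) (D : Set (Set X)) (W : Set X → ℝ≥0∞) (f : X → ℝ) (x : X) :
    ℝ≥0∞ :=
  ⨆ (Q : Set X) (_ : Q ∈ D) (_ : x ∈ Q), weightedAvg μ W f Q

theorem measurable_weightedMaximal {D : Set (Set X)} (hc : D.Countable)
    (hm : ∀ Q ∈ D, MeasurableSet Q) (μ : Measure X) (W : Set X → ℝ≥0∞) (f : X → ℝ) :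
    Measurable (weightedMaximal μ D W f) := by
  refine Measurable.biSup D hc fun Q hQ => ?_
  have : (fun x => ⨆ (_ : x ∈ Q), weightedAvg μ W f Q)
      = Q.indicator fun _ => weightedAvg μ W f Q := by
    ext x
    by_cases hx : x ∈ Q <;> simp [hx]
  rw [this]
  exact measurable_const.indicator (hm Q hQ)

/-- The maximal function of a grid is controlled in `L^q` by a sparse sum. -/
theorem IsGrid.exists_lintegral_le {D : Set (Set X)} {rank : Set X → ℕ} (hD : IsGrid D rank)
    (μ : Measure X) (W : Set X → ℝ≥0∞) (f : X → ℝ) {K : ℝ≥0} (hK : 1 ≤ K)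
    (hW : ∀ P ∈ D, ∀ Q ∈ D, P ⊆ Q → μ P * W P ≤ K * (μ Q * W Q))
    (hWt : ∀ Q ∈ D, W Q ≠ 0) (hμ : ∀ Q ∈ D, μ Q ≠ ∞) {q : ℝ} (hq : 0 < q) :
    ∃ S ⊆ D, (∃ E : Set X → Set X, (∀ Q ∈ S, MeasurableSet (E Q)) ∧ (∀ Q ∈ S, E Q ⊆ Q) ∧
        (∀ P ∈ S, ∀ Q ∈ S, P ≠ Q → Disjoint (E P) (E Q)) ∧ ∀ Q ∈ S, μ Q / 2 ≤ μ (E Q)) ∧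
      ∫⁻ x, weightedMaximal μ D W f x ^ q ∂μ ≤
        (2 * K : ℝ≥0∞) ^ q * ∑' Q : S, μ Q * weightedAvg μ W f Q ^ q := by
  obtain ⟨S, hSD, hE, hcov⟩ := hD.exists_sparse μ W f hK hW hWt hμ
  refine ⟨S, hSD, hE, ?_⟩
  have : Countable S := (hD.countable.mono hSD).to_subtype
  set g := weightedAvg μ W f with hg
  have hpt : ∀ x, weightedMaximal μ D W f x ^ q ≤
      (2 * K : ℝ≥0∞) ^ q * ∑' Q : S, (Q : Set X).indicator (fun _ => g Q ^ q) x := by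
    intro x
    set T := (2 * K : ℝ≥0∞) ^ q * ∑' Q : S, (Q : Set X).indicator (fun _ => g Q ^ q) x
    suffices weightedMaximal μ D W f x ≤ T ^ (1 / q) by
      calc _ ≤ (T ^ (1 / q)) ^ q := ENNReal.rpow_le_rpow this hq.le
        _ = T := by rw [← ENNReal.rpow_mul]; simp [hq.ne']
    refine iSup_le fun Q => iSup_le fun hQ => iSup_le fun hx => ?_
    obtain ⟨P, hP, hQP, hle⟩ := hcov Q hQ
    rw [one_div, ENNReal.le_rpow_inv_iff hq]
    calc _ ≤ (2 * K * g P) ^ q := ENNReal.rpow_le_rpow hle hq.le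
      _ = (2 * K : ℝ≥0∞) ^ q * g P ^ q := ENNReal.mul_rpow_of_nonneg _ _ hq.le
      _ = (2 * K : ℝ≥0∞) ^ q * (P : Set X).indicator (fun _ => g P ^ q) x := by
          rw [indicator_of_mem (hQP hx)]
      -- A single selected set containing `x` already suffices, so one term of the sum is enough.
      _ ≤ _ := by
          refine mul_le_mul' le_rfl ?_
          exact ENNReal.le_tsum (f := fun Q : S => (Q : Set X).indicator (fun _ => g Q ^ q) x)
            ⟨P, hP⟩
  have hm : ∀ Q : S, MeasurableSet (Q : Set X) := fun Q => hD.measurableSet Q (hSD Q.2)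
  calc _ ≤ ∫⁻ x, (2 * K : ℝ≥0∞) ^ q * ∑' Q : S, (Q : Set X).indicator (fun _ => g Q ^ q) x ∂μ :=
        lintegral_mono hpt
    _ = (2 * K : ℝ≥0∞) ^ q * ∑' Q : S, ∫⁻ x, (Q : Set X).indicator (fun _ => g Q ^ q) x ∂μ := by
        rw [lintegral_const_mul _ (Measurable.tsum fun Q =>
          measurable_const.indicator (hm Q)),
          lintegral_tsum fun Q => (measurable_const.indicator (hm Q)).aemeasurable]
    _ = _ := by
        congr 2
        ext Q
        rw [lintegral_indicator_const (hm Q), mul_comm]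

/-- A sparse sum is controlled by the `L^q` norm of the maximal function. -/
theorem tsum_le_lintegral_weightedMaximal {ι : Type*} [Countable ι] {D : Set (Set X)}
    (μ : Measure X) (W : Set X → ℝ≥0∞) (f : X → ℝ) {Ω : Set X} (hΩ : ∀ Q ∈ D, Q ⊆ Ω)
    {Q E : ι → Set X} (hQ : ∀ i, Q i ∈ D) (hE : ∀ i, MeasurableSet (E i)) (hEQ : ∀ i, E i ⊆ Q i)
    (hd : ∀ i j, i ≠ j → Disjoint (E i) (E j)) (hhalf : ∀ i, μ (Q i) / 2 ≤ μ (E i))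
    {q : ℝ} (hq : 0 < q) :
    ∑' i, μ (Q i) * weightedAvg μ W f (Q i) ^ q ≤
      2 * ∫⁻ x in Ω, weightedMaximal μ D W f x ^ q ∂μ := by
  calc ∑' i, μ (Q i) * weightedAvg μ W f (Q i) ^ q
      ≤ ∑' i, 2 * ∫⁻ x in E i, weightedMaximal μ D W f x ^ q ∂μ := by
        refine ENNReal.tsum_le_tsum fun i => ?_
        have h1 : μ (Q i) ≤ 2 * μ (E i) := by
          have := hhalf i
          rwa [ENNReal.div_le_iff_le_mul (by simp) (by simp), mul_comm] at this
        calc _ ≤ 2 * μ (E i) * weightedAvg μ W f (Q i) ^ q := by gcongr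
          _ = 2 * ∫⁻ x in E i, weightedAvg μ W f (Q i) ^ q ∂μ := by
              rw [setLIntegral_const]; ring
          _ ≤ _ := by
              gcongr 2 * ?_
              refine setLIntegral_mono' (hE i) fun x hx => ENNReal.rpow_le_rpow ?_ hq.le
              exact le_iSup_of_le (Q i) (le_iSup_of_le (hQ i) (le_iSup_of_le (hEQ i hx) le_rfl))
    _ = 2 * ∫⁻ x in ⋃ i, E i, weightedMaximal μ D W f x ^ q ∂μ := by
        rw [ENNReal.tsum_mul_left, lintegral_iUnion hE fun i j h => hd i j h]
    _ ≤ _ := by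
        gcongr
        exact iUnion_subset fun i => (hEQ i).trans (hΩ _ (hQ i))

/-! ### Almost monotonicity of the weight -/

theorem one_le_logBase (t : ℝ) : 1 ≤ 1 - min (Real.log t) 0 := by
  linarith [min_le_right (Real.log t) 0]

theorem logWeight_pos (α t : ℝ) : 0 < logWeight α t :=
  Real.rpow_pos_of_pos (zero_lt_one.trans_le (one_le_logBase t)) α

/-- A positive power times the logarithmic weight is almost increasing. -/
theorem exists_rpow_mul_logWeight_le {θ α : ℝ} (hθ : 0 ≤ θ) (hα : θ = 0 → α ≤ 0) :
    ∃ K : ℝ≥0, 1 ≤ K ∧ ∀ t u : ℝ, 0 < t → t ≤ u →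
      t ^ θ * logWeight α t ≤ K * (u ^ θ * logWeight α u) := by
  have hanti : ∀ t u : ℝ, 0 < t → t ≤ u → 1 - min (Real.log u) 0 ≤ 1 - min (Real.log t) 0 := by
    intro t u ht htu
    have := min_le_min_right 0 (Real.log_le_log ht htu)
    linarith
  rcases le_or_gt α 0 with hα0 | hα0
  · refine ⟨1, le_rfl, fun t u ht htu => ?_⟩
    rw [NNReal.coe_one, one_mul]
    refine mul_le_mul (Real.rpow_le_rpow ht.le htu hθ) ?_ (logWeight_pos α t).le
      (Real.rpow_nonneg (ht.le.trans htu) θ)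
    exact Real.rpow_le_rpow_of_nonpos (zero_lt_one.trans_le (one_le_logBase u))
      (hanti t u ht htu) hα0
  have hθ0 : 0 < θ := hθ.lt_of_ne' fun h => hα0.not_ge (hα h)
  -- With this β, exp(βr)^α = (u/t)^θ for r = log(u/t); the constant c gives 1 + r ≤ c(1 + βr).
  set β := θ / α with hβ
  have hβ0 : 0 < β := div_pos hθ0 hα0
  set c : ℝ := max 1 (1 / β) with hc
  have hc1 : 1 ≤ c := le_max_left _ _
  have hcβ : 1 ≤ c * β := by
    have := le_max_right 1 (1 / β)
    rwa [← hc, div_le_iff₀ hβ0] at this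
  refine ⟨⟨c ^ α, by positivity⟩, ?_, fun t u ht htu => ?_⟩
  · exact NNReal.coe_le_coe.1 (Real.one_le_rpow hc1 hα0.le)
  have hu : 0 < u := ht.trans_le htu
  set r := Real.log u - Real.log t with hr
  have hr0 : 0 ≤ r := sub_nonneg.2 (Real.log_le_log ht htu)
  set a := 1 - min (Real.log t) 0 with ha
  set b := 1 - min (Real.log u) 0 with hb
  have hb1 : 1 ≤ b := one_le_logBase u
  have ha1 : 1 ≤ a := one_le_logBase t
  -- The map x ↦ min(x, 0) is 1-Lipschitz.
  have hab : a - b ≤ r := by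
    rcases le_total (Real.log u) 0 with h | h
    · have h' := (Real.log_le_log ht htu).trans h
      simp only [ha, hb, hr, min_eq_left h, min_eq_left h']; linarith
    · rcases le_total (Real.log t) 0 with h' | h'
      · simp only [ha, hb, hr, min_eq_right h, min_eq_left h']; linarith
      · simp only [ha, hb, hr, min_eq_right h, min_eq_right h']; linarith
  have h1 : a ≤ b * (c * Real.exp (β * r)) := by
    have e := Real.add_one_le_exp (β * r)
    have : 1 + r ≤ c * Real.exp (β * r) := by
      calc 1 + r ≤ c * (β * r + 1) := by nlinarith
        _ ≤ _ := by gcongr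
    calc a ≤ b + r := by linarith
      _ ≤ b * (1 + r) := by nlinarith
      _ ≤ _ := by gcongr
  have h2 : t ^ θ * Real.exp (β * r) ^ α = u ^ θ := by
    rw [Real.rpow_def_of_pos ht, Real.rpow_def_of_pos hu, ← Real.exp_mul, ← Real.exp_add, hr, hβ]
    congr 1
    field_simp
    ring
  have h3 : a ^ α ≤ b ^ α * (c ^ α * Real.exp (β * r) ^ α) := by
    calc a ^ α ≤ (b * (c * Real.exp (β * r))) ^ α := by gcongr
      _ = _ := by
        rw [Real.mul_rpow (by positivity) (by positivity),
          Real.mul_rpow (by positivity) (by positivity)]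
  calc t ^ θ * a ^ α ≤ t ^ θ * (b ^ α * (c ^ α * Real.exp (β * r) ^ α)) := by gcongr
    _ = c ^ α * ((t ^ θ * Real.exp (β * r) ^ α) * b ^ α) := by ring
    _ = c ^ α * (u ^ θ * b ^ α) := by rw [h2]

/-! ### Dyadic cubes -/

variable {n : ℕ}

/-- The weight of the maximal function, as a set function. -/
def cubeWeight (s α : ℝ) (Q : Set (Fin n → ℝ)) : ℝ≥0∞ :=
  ENNReal.ofReal (volume.real Q ^ (s / n - 1) * logWeight α (volume.real Q))

theorem cube_eq_pi (a : Fin n → ℝ) (ℓ : ℝ) :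
    cube a ℓ = Set.univ.pi fun i => Ico (a i) (a i + ℓ) := by
  ext x; simp [cube]

theorem measurableSet_cube (a : Fin n → ℝ) (ℓ : ℝ) : MeasurableSet (cube a ℓ) := by
  rw [cube_eq_pi]
  exact MeasurableSet.univ_pi fun i => measurableSet_Ico

theorem volume_cube (a : Fin n → ℝ) (ℓ : ℝ) : volume (cube a ℓ) = ENNReal.ofReal ℓ ^ n := by
  rw [cube_eq_pi, volume_pi_pi]
  simp

/-- The cubes `a + ℓ 2^k (m + [0,1)ⁿ)` of the dyadic grid generated by `cube a ℓ`. -/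
def gridCube (a : Fin n → ℝ) (ℓ : ℝ) (k : ℤ) (m : Fin n → ℤ) : Set (Fin n → ℝ) :=
  cube (fun i => a i + m i * (ℓ * 2 ^ k)) (ℓ * 2 ^ k)

theorem mem_gridCube {a : Fin n → ℝ} {ℓ : ℝ} (hℓ : 0 < ℓ) {k : ℤ} {m : Fin n → ℤ}
    {x : Fin n → ℝ} :
    x ∈ gridCube a ℓ k m ↔ ∀ i, ⌊(x i - a i) / (ℓ * 2 ^ k)⌋ = m i := by
  have h : 0 < ℓ * 2 ^ k := by positivity
  refine forall_congr' fun i => ?_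
  rw [Int.floor_eq_iff, le_div_iff₀ h, div_lt_iff₀ h]
  constructor <;> rintro ⟨h1, h2⟩ <;> constructor <;> linarith

/-- The index of a point at a fine scale determines its index at every coarser scale; nestedness of
dyadic cubes rests on this. -/
theorem floor_div_scale {ℓ : ℝ} {k k' : ℤ} (hk : k ≤ k') (y : ℝ) :
    ⌊y / (ℓ * 2 ^ k')⌋ = ⌊y / (ℓ * 2 ^ k)⌋ / (2 ^ (k' - k).toNat : ℕ) := by
  rw [← Int.floor_div_natCast]
  congr 1
  have h : ((2 ^ (k' - k).toNat : ℕ) : ℝ) = (2 : ℝ) ^ (k' - k) := by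
    rw [Nat.cast_pow, Nat.cast_ofNat, ← zpow_natCast, Int.toNat_of_nonneg (sub_nonneg.2 hk)]
  rw [h, div_div, mul_assoc, ← zpow_add₀ two_ne_zero]
  congr 3
  ring

theorem gridCube_subset {a : Fin n → ℝ} {ℓ : ℝ} (hℓ : 0 < ℓ) {k k' : ℤ} (hk : k ≤ k')
    {m m' : Fin n → ℤ} (h : ¬ Disjoint (gridCube a ℓ k m) (gridCube a ℓ k' m')) :
    gridCube a ℓ k m ⊆ gridCube a ℓ k' m' := by
  obtain ⟨x, hx, hx'⟩ := not_disjoint_iff.1 h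
  intro y hy
  rw [mem_gridCube hℓ] at hx hx' hy ⊢
  intro i
  rw [← hx' i, floor_div_scale hk, floor_div_scale hk, hx i, hy i]

theorem gridCube_nonempty {a : Fin n → ℝ} {ℓ : ℝ} (hℓ : 0 < ℓ) (k : ℤ) (m : Fin n → ℤ) :
    (gridCube a ℓ k m).Nonempty := by
  have h : 0 < ℓ * 2 ^ k := by positivity
  exact ⟨_, fun i => ⟨le_rfl, lt_add_of_pos_right _ h⟩⟩

/-- Dyadic cubes of bounded side length form a grid. -/
theorem exists_isGrid {a : Fin n → ℝ} {ℓ : ℝ} (hℓ : 0 < ℓ) (N : ℤ) {D : Set (Set (Fin n → ℝ))}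
    (hD : ∀ Q ∈ D, ∃ k ≤ N, ∃ m, Q = gridCube a ℓ k m) : ∃ rank, IsGrid D rank := by
  classical
  choose! k hkN m hkm using hD
  -- The rank counts generations below the largest allowed scale; the truncation by `toNat` is
  -- harmless because `k Q ≤ N`.
  refine ⟨fun Q => (N - k Q).toNat, ?_, ?_, ?_, ?_⟩
  · refine (countable_range fun z : ℤ × (Fin n → ℤ) => gridCube a ℓ z.1 z.2).mono fun Q hQ => ?_
    exact ⟨(k Q, m Q), (hkm Q hQ).symm⟩
  · intro Q hQ
    rw [hkm Q hQ]
    exact measurableSet_cube _ _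
  · intro P hP Q hQ
    by_cases hd : Disjoint P Q
    · exact Or.inr (Or.inr hd)
    rcases le_total (k P) (k Q) with h | h
    · left
      rw [hkm P hP, hkm Q hQ] at hd ⊢
      exact gridCube_subset hℓ h hd
    · right; left
      rw [hkm P hP, hkm Q hQ] at hd ⊢
      exact gridCube_subset hℓ h fun h' => hd h'.symm
  · intro P hP Q hQ hPQ
    have hlt : k P < k Q := by
      by_contra hle
      have hne : P.Nonempty := by rw [hkm P hP]; exact gridCube_nonempty hℓ _ _
      have hd : ¬ Disjoint Q P := fun h => hne.ne_empty (h.eq_bot_of_ge hPQ.subset)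
      refine hPQ.not_subset ?_
      rw [hkm P hP, hkm Q hQ] at hd ⊢
      exact gridCube_subset hℓ (not_lt.1 hle) hd
    have := hkN Q hQ
    show (N - k Q).toNat < (N - k P).toNat
    omega

theorem volume_gridCube {a : Fin n → ℝ} {ℓ : ℝ} (hℓ : 0 < ℓ) (k : ℤ) (m : Fin n → ℤ) :
    volume (gridCube a ℓ k m) ≠ 0 ∧ volume (gridCube a ℓ k m) ≠ ∞ := by
  have h : 0 < ℓ * 2 ^ k := by positivity
  rw [gridCube, volume_cube]
  exact ⟨by simpa using fun h' => absurd h' h.not_ge, by simp⟩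

/-! ### Comparison of the two norms -/

/-- The terms of the sparse norm in terms of the weight of the maximal function. -/
theorem sparse_term_eq (hn : n ≠ 0) {p q : ℝ} (α : ℝ) (hq : 0 < q)
    {Q : Set (Fin n → ℝ)} (h0 : volume Q ≠ 0) (ht : volume Q ≠ ∞) (f : (Fin n → ℝ) → ℝ) :
    (ENNReal.ofReal (logWeight α (volume.real Q) / volume.real Q ^ (1 - 1 / p)) *
      ∫⁻ y in Q, ‖f y‖ₑ) ^ q =
    volume Q * weightedAvg volume (cubeWeight (n * (1 / p - 1 / q)) α) f Q ^ q := by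
  have hv : 0 < volume.real Q := ENNReal.toReal_pos h0 ht
  -- The factor |Q| is moved inside the q-th power as |Q|^(1/q); the exponents then add up to 1/p -
  -- 1.
  have hvol : volume Q = ENNReal.ofReal (volume.real Q ^ (1 / q)) ^ q := by
    rw [ENNReal.ofReal_rpow_of_nonneg (by positivity) hq.le, ← Real.rpow_mul hv.le,
      one_div_mul_cancel hq.ne', Real.rpow_one, Measure.real, ENNReal.ofReal_toReal ht]
  have hn' : (n : ℝ) ≠ 0 := by exact_mod_cast hn
  conv_rhs => rw [hvol]
  rw [← ENNReal.mul_rpow_of_nonneg _ _ hq.le, weightedAvg, cubeWeight, ← mul_assoc,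
    ← ENNReal.ofReal_mul (by positivity), mul_div_cancel_left₀ _ hn', ← mul_assoc,
    ← Real.rpow_add hv, div_eq_mul_inv, ← Real.rpow_neg hv.le, mul_comm (logWeight _ _)]
  congr 5
  ring

theorem cubeWeight_ne_zero (s α : ℝ) {Q : Set (Fin n → ℝ)} (h0 : volume Q ≠ 0)
    (ht : volume Q ≠ ∞) : cubeWeight s α Q ≠ 0 := by
  have hv : 0 < volume.real Q := ENNReal.toReal_pos h0 ht
  have := logWeight_pos α (volume.real Q)
  simp only [cubeWeight, ne_eq, ENNReal.ofReal_eq_zero, not_le]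
  positivity

/-- The factor |Q| cancels the -1 in the exponent, leaving exactly the function of |Q| proved almost
increasing. -/
theorem volume_mul_cubeWeight (s α : ℝ) {Q : Set (Fin n → ℝ)} (h0 : volume Q ≠ 0)
    (ht : volume Q ≠ ∞) : volume Q * cubeWeight s α Q =
      ENNReal.ofReal (volume.real Q ^ (s / n) * logWeight α (volume.real Q)) := by
  have hv : 0 < volume.real Q := ENNReal.toReal_pos h0 ht
  have hvol : volume Q = ENNReal.ofReal (volume.real Q) := (ENNReal.ofReal_toReal ht).symm
  conv_lhs => rw [hvol]
  rw [cubeWeight, ← ENNReal.ofReal_mul hv.le, ← mul_assoc]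
  congr 2
  rw [Real.rpow_sub_one hv.ne']
  field_simp

theorem eLpNorm_maximalFn (D : Set (Set (Fin n → ℝ))) (s α : ℝ) (f : (Fin n → ℝ) → ℝ)
    (μ : Measure (Fin n → ℝ)) {q : ℝ} (hq : 0 < q) :
    eLpNorm (maximalFn D s α f) (ENNReal.ofReal q) μ =
      (∫⁻ x, maximalFn D s α f x ^ q ∂μ) ^ (1 / q) := by
  rw [eLpNorm_eq_lintegral_rpow_enorm_toReal (by simpa using hq) (by simp),
    ENNReal.toReal_ofReal hq.le]
  simp

/-- The sparse norm is controlled by the maximal function. -/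
theorem sparseNorm_le (hn : n ≠ 0) {p q α : ℝ} (hq : 1 ≤ q) {D : Set (Set (Fin n → ℝ))}
    (hv : ∀ Q ∈ D, volume Q ≠ 0 ∧ volume Q ≠ ∞) {Ω : Set (Fin n → ℝ)} (hΩ : ∀ Q ∈ D, Q ⊆ Ω)
    (f : (Fin n → ℝ) → ℝ) :
    sparseNorm D p q α f ≤
      2 * eLpNorm (maximalFn D (n * (1 / p - 1 / q)) α f) (ENNReal.ofReal q)
        (volume.restrict Ω) := by
  have hq0 : 0 < q := zero_lt_one.trans_le hq
  rw [eLpNorm_maximalFn _ _ _ _ _ hq0]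
  refine iSup_le fun I => iSup_le fun Q => iSup_le fun hQ => iSup_le fun hs => ?_
  obtain ⟨E, hE, hEQ, hd, hhalf⟩ := hs
  -- `maximalFn` is by definition `weightedMaximal` with weight `cubeWeight`.
  have key := tsum_le_lintegral_weightedMaximal volume (cubeWeight (n * (1 / p - 1 / q)) α) f
    hΩ hQ hE hEQ hd hhalf hq0
  simp_rw [sparse_term_eq hn α hq0 (hv _ (hQ _)).1 (hv _ (hQ _)).2 f]
  calc _ ≤ (2 * ∫⁻ x in Ω, maximalFn D (n * (1 / p - 1 / q)) α f x ^ q) ^ (1 / q) :=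
        ENNReal.rpow_le_rpow key (by positivity)
    _ = 2 ^ (1 / q) * (∫⁻ x in Ω, maximalFn D (n * (1 / p - 1 / q)) α f x ^ q) ^ (1 / q) :=
        ENNReal.mul_rpow_of_nonneg _ _ (by positivity)
    _ ≤ _ := by
        gcongr
        calc (2 : ℝ≥0∞) ^ (1 / q) ≤ 2 ^ (1 : ℝ) :=
              ENNReal.rpow_le_rpow_of_exponent_le (by norm_num)
                ((div_le_one hq0).2 hq)
          _ = 2 := ENNReal.rpow_one 2

/-- Sums over sparse sets of members of `D` are bounded by the sparse norm. -/
theorem tsum_rpow_le_sparseNorm {p q α : ℝ} {D S : Set (Set (Fin n → ℝ))} (hSc : S.Countable)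
    (hSD : S ⊆ D) {E : Set (Fin n → ℝ) → Set (Fin n → ℝ)} (hE : ∀ Q ∈ S, MeasurableSet (E Q))
    (hEQ : ∀ Q ∈ S, E Q ⊆ Q) (hd : ∀ P ∈ S, ∀ Q ∈ S, P ≠ Q → Disjoint (E P) (E Q))
    (hhalf : ∀ Q ∈ S, volume Q / 2 ≤ volume (E Q)) (f : (Fin n → ℝ) → ℝ) :
    (∑' Q : S, (ENNReal.ofReal (logWeight α (volume.real (Q : Set (Fin n → ℝ))) /
      volume.real (Q : Set (Fin n → ℝ)) ^ (1 - 1 / p)) * ∫⁻ y in Q, ‖f y‖ₑ) ^ q) ^ (1 / q) ≤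
      sparseNorm D p q α f := by
  obtain ⟨j, hj⟩ := hSc.to_subtype.exists_injective_nat
  let e : S ≃ range j := Equiv.ofInjective j hj
  rw [← e.symm.tsum_eq]
  refine le_iSup_of_le (range j) (le_iSup_of_le (fun i => (e.symm i : Set (Fin n → ℝ)))
    (le_iSup_of_le (fun i => hSD (e.symm i).2) (le_iSup_of_le ?_ le_rfl)))
  exact ⟨fun i => E (e.symm i), fun i => hE _ (e.symm i).2, fun i => hEQ _ (e.symm i).2,
    fun i i' h => hd _ (e.symm i).2 _ (e.symm i').2 fun h' =>
      h (e.symm.injective (Subtype.ext h')), fun i => hhalf _ (e.symm i).2⟩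

/-- The maximal function of a family of dyadic cubes of bounded size is controlled by the sparse
norm of any larger family. -/
theorem lintegral_maximalFn_le_of_bounded (hn : n ≠ 0) {p q α : ℝ} (hq : 0 < q) {K : ℝ≥0}
    (hK : 1 ≤ K) (hφ : ∀ t u : ℝ, 0 < t → t ≤ u →
      t ^ (1 / p - 1 / q) * logWeight α t ≤ K * (u ^ (1 / p - 1 / q) * logWeight α u))
    {a : Fin n → ℝ} {ℓ : ℝ} (hℓ : 0 < ℓ) (N : ℤ) {D D' : Set (Set (Fin n → ℝ))}
    (hD : ∀ Q ∈ D, ∃ k ≤ N, ∃ m, Q = gridCube a ℓ k m) (hDD' : D ⊆ D')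
    (f : (Fin n → ℝ) → ℝ) :
    ∫⁻ x, maximalFn D (n * (1 / p - 1 / q)) α f x ^ q ≤
      (2 * K * sparseNorm D' p q α f) ^ q := by
  obtain ⟨rank, hgrid⟩ := exists_isGrid hℓ N hD
  have hv : ∀ Q ∈ D, volume Q ≠ 0 ∧ volume Q ≠ ∞ := by
    intro Q hQ
    obtain ⟨k, -, m, rfl⟩ := hD Q hQ
    exact volume_gridCube hℓ k m
  have hn' : (n : ℝ) ≠ 0 := by exact_mod_cast hn
  have hW : ∀ P ∈ D, ∀ Q ∈ D, P ⊆ Q →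
      volume P * cubeWeight (n * (1 / p - 1 / q)) α P ≤
        K * (volume Q * cubeWeight (n * (1 / p - 1 / q)) α Q) := by
    intro P hP Q hQ hPQ
    rw [volume_mul_cubeWeight _ _ (hv P hP).1 (hv P hP).2,
      volume_mul_cubeWeight _ _ (hv Q hQ).1 (hv Q hQ).2, mul_div_cancel_left₀ _ hn',
      ← ENNReal.ofReal_coe_nnreal, ← ENNReal.ofReal_mul K.coe_nonneg]
    exact ENNReal.ofReal_le_ofReal (hφ _ _ (ENNReal.toReal_pos (hv P hP).1 (hv P hP).2)
      (ENNReal.toReal_mono (hv Q hQ).2 (measure_mono hPQ)))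
  obtain ⟨S, hSD, ⟨E, hE, hEQ, hd, hhalf⟩, hle⟩ := hgrid.exists_lintegral_le volume
    (cubeWeight (n * (1 / p - 1 / q)) α) f hK hW
    (fun Q hQ => cubeWeight_ne_zero _ _ (hv Q hQ).1 (hv Q hQ).2) (fun Q hQ => (hv Q hQ).2) hq
  have hsp := tsum_rpow_le_sparseNorm (p := p) (q := q) (α := α) (hgrid.countable.mono hSD)
    (hSD.trans hDD') hE hEQ hd hhalf f
  rw [one_div q, ENNReal.rpow_inv_le_iff hq] at hsp
  refine hle.trans ?_
  rw [ENNReal.mul_rpow_of_nonneg (2 * K) _ hq.le]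
  refine mul_le_mul' le_rfl (le_trans (le_of_eq ?_) hsp)
  refine tsum_congr fun Q => ?_
  exact (sparse_term_eq hn α hq (hv Q (hSD Q.2)).1 (hv Q (hSD Q.2)).2 f).symm

/-- The maximal function of a family of dyadic cubes is controlled by the sparse norm. -/
theorem lintegral_maximalFn_le (hn : n ≠ 0) {p q α : ℝ} (hq : 0 < q) {K : ℝ≥0}
    (hK : 1 ≤ K) (hφ : ∀ t u : ℝ, 0 < t → t ≤ u →
      t ^ (1 / p - 1 / q) * logWeight α t ≤ K * (u ^ (1 / p - 1 / q) * logWeight α u))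
    {a : Fin n → ℝ} {ℓ : ℝ} (hℓ : 0 < ℓ) {D : Set (Set (Fin n → ℝ))}
    (hD : ∀ Q ∈ D, ∃ k m, Q = gridCube a ℓ k m) (f : (Fin n → ℝ) → ℝ) :
    ∫⁻ x, maximalFn D (n * (1 / p - 1 / q)) α f x ^ q ≤
      (2 * K * sparseNorm D p q α f) ^ q := by
  -- Truncation to side lengths at most ℓ 2^N, where selection applies; the truncated maximal
  -- functions increase with N.
  let T : ℕ → Set (Set (Fin n → ℝ)) := fun N =>
    {Q | Q ∈ D ∧ ∃ k ≤ (N : ℤ), ∃ m, Q = gridCube a ℓ k m}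
  have hT : ∀ N, ∀ Q ∈ T N, ∃ k ≤ (N : ℤ), ∃ m, Q = gridCube a ℓ k m := fun N Q h => h.2
  have hTmono : Monotone T := fun N N' h Q hQ =>
    ⟨hQ.1, hQ.2.imp fun k hk => ⟨hk.1.trans (by exact_mod_cast h), hk.2⟩⟩
  set s := (n : ℝ) * (1 / p - 1 / q)
  have hmono : Monotone fun N x => maximalFn (T N) s α f x ^ q := fun N N' h x =>
    ENNReal.rpow_le_rpow (biSup_mono fun Q hQ => hTmono h hQ) hq.le
  have hsup : ∀ x, maximalFn D s α f x ^ q ≤ ⨆ N, maximalFn (T N) s α f x ^ q := by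
    intro x
    rw [← ENNReal.le_rpow_inv_iff hq]
    refine iSup_le fun Q => iSup_le fun hQ => iSup_le fun hx => ?_
    rw [ENNReal.le_rpow_inv_iff hq]
    obtain ⟨k, m, hkm⟩ := hD Q hQ
    refine le_iSup_of_le k.toNat (ENNReal.rpow_le_rpow ?_ hq.le)
    exact le_iSup_of_le Q (le_iSup_of_le ⟨hQ, k, Int.self_le_toNat k, m, hkm⟩
      (le_iSup_of_le hx le_rfl))
  calc _ ≤ ∫⁻ x, ⨆ N, maximalFn (T N) s α f x ^ q := lintegral_mono hsup
    _ = ⨆ N, ∫⁻ x, maximalFn (T N) s α f x ^ q := by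
        refine lintegral_iSup (fun N => ?_) hmono
        obtain ⟨rank, hgrid⟩ := exists_isGrid hℓ N (hT N)
        exact (measurable_weightedMaximal hgrid.countable hgrid.measurableSet volume
          (cubeWeight s α) f).pow_const q
    _ ≤ _ := iSup_le fun N => lintegral_maximalFn_le_of_bounded hn hq hK hφ hℓ N (hT N)
        (fun Q h => h.1) f

theorem dyadicIn_subset_cube {a : Fin n → ℝ} {ℓ : ℝ} (hℓ : 0 < ℓ) {Q : Set (Fin n → ℝ)}
    (hQ : Q ∈ dyadicIn a ℓ) : Q ⊆ cube a ℓ := by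
  obtain ⟨k, m, hm, rfl⟩ := hQ
  intro x hx i
  obtain ⟨h1, h2⟩ := hx i
  have hd : 0 < ℓ / 2 ^ k := by positivity
  have hm' : (m i : ℝ) + 1 ≤ 2 ^ k := by exact_mod_cast hm i
  have h3 : ((m i : ℝ) + 1) * (ℓ / 2 ^ k) ≤ ℓ := by
    calc _ ≤ 2 ^ k * (ℓ / 2 ^ k) := by gcongr
      _ = ℓ := by field_simp
  have h4 : 0 ≤ (m i : ℝ) * (ℓ / 2 ^ k) := by positivity
  constructor <;> linarith

theorem exists_gridCube_of_mem_dyadicIn {a : Fin n → ℝ} {ℓ : ℝ} {Q : Set (Fin n → ℝ)}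
    (hQ : Q ∈ dyadicIn a ℓ) : ∃ k m, Q = gridCube a ℓ k m := by
  obtain ⟨k, m, -, rfl⟩ := hQ
  -- Generation k has side length ℓ 2^(-k).
  refine ⟨-k, fun i => m i, ?_⟩
  simp [gridCube, div_eq_mul_inv]

theorem exists_gridCube_of_mem_dyadic {Q : Set (Fin n → ℝ)} (hQ : Q ∈ dyadic n) :
    ∃ k m, Q = gridCube 0 1 k m := by
  obtain ⟨k, m, rfl⟩ := hQ
  exact ⟨k, m, by simp [gridCube]⟩

/-- The two norms are comparable for any family of dyadic cubes contained in `Ω`. -/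
theorem sparseNorm_comparable (hn : n ≠ 0) {p q α : ℝ} (hq : 1 ≤ q) {K : ℝ≥0}
    (hK : 1 ≤ K) (hφ : ∀ t u : ℝ, 0 < t → t ≤ u →
      t ^ (1 / p - 1 / q) * logWeight α t ≤ K * (u ^ (1 / p - 1 / q) * logWeight α u))
    {a : Fin n → ℝ} {ℓ : ℝ} (hℓ : 0 < ℓ) {D : Set (Set (Fin n → ℝ))}
    (hD : ∀ Q ∈ D, ∃ k m, Q = gridCube a ℓ k m) {Ω : Set (Fin n → ℝ)} (hΩ : ∀ Q ∈ D, Q ⊆ Ω)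
    (f : (Fin n → ℝ) → ℝ) :
    sparseNorm D p q α f ≤
        (2 * K : ℝ≥0) * eLpNorm (maximalFn D (n * (1 / p - 1 / q)) α f) (ENNReal.ofReal q)
          (volume.restrict Ω) ∧
      eLpNorm (maximalFn D (n * (1 / p - 1 / q)) α f) (ENNReal.ofReal q) (volume.restrict Ω) ≤
        (2 * K : ℝ≥0) * sparseNorm D p q α f := by
  have hq0 : 0 < q := zero_lt_one.trans_le hq
  have hK' : (1 : ℝ≥0∞) ≤ K := by exact_mod_cast hK
  rw [ENNReal.coe_mul, ENNReal.coe_ofNat]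
  constructor
  · refine (sparseNorm_le hn hq ?_ hΩ f).trans (mul_le_mul' (le_mul_of_one_le_right' hK') le_rfl)
    intro Q hQ
    obtain ⟨k, m, rfl⟩ := hD Q hQ
    exact volume_gridCube hℓ k m
  · rw [eLpNorm_maximalFn _ _ _ _ _ hq0, one_div q, ENNReal.rpow_inv_le_iff hq0, ← one_div q]
    exact (setLIntegral_le_lintegral _ _).trans (lintegral_maximalFn_le hn hq0 hK hφ hℓ hD f)

end

end SparseRMT

theorem theorem3p1 (n : ℕ) (hn : 1 ≤ n) (p q α : ℝ) (hp : 1 ≤ p) (hpq : p ≤ q)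
    (hα : p = q → α ≤ 0) :
    ∃ C : ℝ≥0, 0 < C ∧
      (∀ (a : Fin n → ℝ) (ℓ : ℝ), 0 < ℓ →
        SparseRMT.sparseSpaceOn a ℓ p q α =
            SparseRMT.maximalSpaceOn a ℓ (n * (1 / p - 1 / q)) α q ∧
        ∀ f : (Fin n → ℝ) → ℝ, IntegrableOn f (SparseRMT.cube a ℓ) →
          SparseRMT.sparseNorm (SparseRMT.dyadicIn a ℓ) p q α f ≤
            C * eLpNorm
              (SparseRMT.maximalFn (SparseRMT.dyadicIn a ℓ) (n * (1 / p - 1 / q)) α f)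
              (ENNReal.ofReal q) (volume.restrict (SparseRMT.cube a ℓ)) ∧
          eLpNorm (SparseRMT.maximalFn (SparseRMT.dyadicIn a ℓ) (n * (1 / p - 1 / q)) α f)
              (ENNReal.ofReal q) (volume.restrict (SparseRMT.cube a ℓ)) ≤
            C * SparseRMT.sparseNorm (SparseRMT.dyadicIn a ℓ) p q α f) ∧
      (SparseRMT.sparseSpace n p q α =
          SparseRMT.maximalSpace n (n * (1 / p - 1 / q)) α q ∧
        ∀ f : (Fin n → ℝ) → ℝ, LocallyIntegrable f →
          SparseRMT.sparseNorm (SparseRMT.dyadic n) p q α f ≤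
            C * eLpNorm (SparseRMT.maximalFn (SparseRMT.dyadic n) (n * (1 / p - 1 / q)) α f)
              (ENNReal.ofReal q) volume ∧
          eLpNorm (SparseRMT.maximalFn (SparseRMT.dyadic n) (n * (1 / p - 1 / q)) α f)
              (ENNReal.ofReal q) volume ≤
            C * SparseRMT.sparseNorm (SparseRMT.dyadic n) p q α f) := by
  have hp0 : 0 < p := zero_lt_one.trans_le hp
  have hq : 1 ≤ q := hp.trans hpq
  have hn0 : n ≠ 0 := Nat.one_le_iff_ne_zero.1 hn
  -- Here θ = λ/n vanishes only if p = q, the case in which α ≤ 0 is assumed.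
  obtain ⟨K, hK, hφ⟩ := SparseRMT.exists_rpow_mul_logWeight_le (θ := 1 / p - 1 / q) (α := α)
    (sub_nonneg.2 (one_div_le_one_div_of_le hp0 hpq)) fun h => hα (by
      rw [sub_eq_zero] at h
      simpa using h)
  have hfin : ∀ {x y : ℝ≥0∞}, x ≤ (2 * K : ℝ≥0) * y → y < ∞ → x < ∞ := fun h hy =>
    h.trans_lt (ENNReal.mul_lt_top ENNReal.coe_lt_top hy)
  refine ⟨2 * K, mul_pos two_pos (zero_lt_one.trans_le hK), fun a ℓ hℓ => ?_, ?_⟩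
  · have h := SparseRMT.sparseNorm_comparable hn0 hq hK hφ hℓ
      (fun Q => SparseRMT.exists_gridCube_of_mem_dyadicIn (a := a))
      (fun Q hQ => SparseRMT.dyadicIn_subset_cube hℓ hQ)
    refine ⟨?_, fun f _ => h f⟩
    ext f
    exact and_congr_right fun _ => ⟨hfin (h f).2, hfin (h f).1⟩
  · have h := SparseRMT.sparseNorm_comparable hn0 hq hK hφ one_pos
      (fun Q => SparseRMT.exists_gridCube_of_mem_dyadic (n := n)) (fun Q _ => Set.subset_univ Q)
    simp only [Measure.restrict_univ] at h
    refine ⟨?_, fun f _ => h f⟩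
    ext f
    exact and_congr_right fun _ => ⟨hfin (h f).2, hfin (h f).1⟩
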